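/- Let $k$ be a field and let $A=k[x^{(1)}_1,x^{(2)}_1,x^{(2)}_2,\dots,x^{(n)}_1,\dots,x^{(n)}_n,\dots]$ be the polynomial ring over $k$ in the infinitely many variables $x^{(n)}_i$ $(n\ge 1,\ 1\le i\le n)$. For every integer $n\ge 1$ let $\mathfrak m_nA$ be the ideal of $A$ generated by $x^{(n)}_1,\dots,x^{(n)}_n$, which is a prime ideal. Put $S:=A\setminus\bigcup_{n\ge 1}\mathfrak m_nA$, which is a multiplicative subset of $A$, and $B:=S^{-1}A$. Then $B$ is a regular ring, i.e. $B$ is noetherian and the local ring $B_{\mathfrak p}$ is regular for every prime ideal $\mathfrak p$ of $B$. In particular, $B$ is universally catenary, i.e. $B$ is noetherian and every finitely generated (commutative) $B$-algebra $C$ is catenary: for any prime ideals $\mathfrak p\subseteq\mathfrak q$ of $C$, the lengths of the chains of prime ideals from $\mathfrak p$ to $\mathfrak q$ are bounded and all maximal such chains have the same length. -/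

import Mathlib

universe u

/-- A commutative ring is catenary if, for all primes `p ⊆ q`, the lengths of the finite chains of
primes from `p` to `q` are bounded, and all maximal (i.e. saturated) chains of primes from `p` to
`q` have the same length. -/
def IsCatenaryRing (R : Type u) [CommRing R] : Prop :=
  ∀ p q : PrimeSpectrum R, p ≤ q → ∃ n : ℕ,
    (∀ s : LTSeries (PrimeSpectrum R), s.head = p → s.last = q → s.length ≤ n) ∧
    (∀ s : RelSeries {(a, b) : PrimeSpectrum R × PrimeSpectrum R | a ⋖ b},
      s.head = p → s.last = q → s.length = n)

/-- A noetherian ring is universally catenary if every finitely generated algebra over it is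
catenary. (Every finitely generated `R`-algebra is isomorphic to a quotient of some
`R[y₁, …, yₘ]`, so it is enough to consider algebras in the universe of `R`.) -/
structure IsUniversallyCatenaryRing (R : Type u) [CommRing R] : Prop where
  isNoetherianRing : IsNoetherianRing R
  isCatenaryRing : ∀ (C : Type u) [CommRing C] [Algebra R C],
    Algebra.FiniteType R C → IsCatenaryRing C

namespace NagataExample

/-- The index set of the variables `x⁽ⁿ⁾ᵢ`: for each integer `n ≥ 1` there are `n` of them. -/
abbrev Index : Type := Σ n : ℕ+, Fin (n : ℕ)

/-- The polynomial ring `A = k[x⁽¹⁾₁, x⁽²⁾₁, x⁽²⁾₂, …, x⁽ⁿ⁾₁, …, x⁽ⁿ⁾ₙ, …]`. -/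
abbrev A (k : Type u) [Field k] : Type u := MvPolynomial Index k

/-- The ideal `𝔪ₙ A` of `A`, generated by `x⁽ⁿ⁾₁, …, x⁽ⁿ⁾ₙ`. -/
noncomputable def mA (k : Type u) [Field k] (n : ℕ+) : Ideal (A k) :=
  Ideal.span (Set.range fun i : Fin (n : ℕ) => (MvPolynomial.X ⟨n, i⟩ : A k))

theorem mA_isPrime (k : Type u) [Field k] (n : ℕ+) : (mA k n).IsPrime := by
  classical
  let φ : A k →ₐ[k] A k :=
    MvPolynomial.aeval fun j : Index => if j.1 = n then 0 else MvPolynomial.X j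
  have key : ∀ f : A k, f - φ f ∈ mA k n := by
    intro f
    rw [← Ideal.Quotient.eq]
    have h : (Ideal.Quotient.mkₐ k (mA k n)) = (Ideal.Quotient.mkₐ k (mA k n)).comp φ := by
      ext ⟨m, i⟩
      by_cases hm : m = n
      · subst hm
        simp only [φ, AlgHom.comp_apply, MvPolynomial.aeval_X, if_true, map_zero]
        exact Ideal.Quotient.eq_zero_iff_mem.2 (Ideal.subset_span ⟨i, rfl⟩)
      · simp [φ, hm]
    exact DFunLike.congr_fun h f
  have hker : mA k n = RingHom.ker φ.toRingHom := by
    apply le_antisymm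
    · refine Ideal.span_le.2 ?_
      rintro _ ⟨i, rfl⟩
      simp [φ, RingHom.mem_ker]
    · intro f hf
      have h0 : φ f = 0 := hf
      simpa [h0] using key f
  rw [hker]
  exact RingHom.ker_isPrime _

/-- The multiplicative subset `S = A ∖ ⋃ₙ 𝔪ₙ A = ⋂ₙ (A ∖ 𝔪ₙ A)`. -/
def S (k : Type u) [Field k] : Submonoid (A k) where
  carrier := {f | ∀ n : ℕ+, f ∉ mA k n}
  one_mem' n := (Ideal.ne_top_iff_one _).1 (mA_isPrime k n).ne_top
  mul_mem' hf hg n h := ((mA_isPrime k n).mem_or_mem h).elim (hf n) (hg n)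

/-- Nagata's ring `B = S⁻¹ A`. -/
abbrev B (k : Type u) [Field k] : Type u := Localization (S k)

end NagataExample

/-!
An ideal of `A` contained in `⋃ₙ 𝔪ₙA` lies in a single `𝔪ₙA`: if `f ≠ 0` is in the ideal, only
finitely many `𝔪ₙA` contain `f`, and if none of these contains the ideal, prime avoidance yields an
element `g` of the ideal outside all of them; for large `N` the polynomials `f` and `g ^ N` have no
monomial in common, so `f + g ^ N` lies in no `𝔪ₙA`. Hence every prime of `B` comes from a prime of
`A` inside some `𝔪ₙA`. Such a prime contains no nonzero polynomial in the variables outside the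
`n`-th block, so its local ring is a local ring of `K[x⁽ⁿ⁾₁, …, x⁽ⁿ⁾ₙ]`, where `K` is the fraction
field of the polynomial ring in those other variables; in particular it is regular.

`B` is noetherian by Nagata's criterion, since its local rings are noetherian and each nonzero
element lies in finitely many maximal ideals. The local rings of a finitely generated `B`-algebra
are localizations of finitely generated algebras `R` over a field, whose spectrum is graded by
`𝔭 ↦ -dim (R / 𝔭)`.
-/

section Catenary

section GradeOrder

variable {α : Type*} [Preorder α] [GradeOrder ℤ α]

theorem length_add_grade_head_le_grade_last (s : LTSeries α) :
    s.length + grade ℤ s.head ≤ grade ℤ s.last :=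
  (add_comm _ _).trans_le (s.map (grade ℤ) grade_strictMono).head_add_length_le_int

theorem length_add_grade_head_eq_grade_last (s : RelSeries {(a, b) : α × α | a ⋖ b}) :
    s.length + grade ℤ s.head = grade ℤ s.last := by
  suffices h : ∀ i : Fin (s.length + 1), (i : ℕ) + grade ℤ s.head = grade ℤ (s i) from
    h (Fin.last _)
  intro i
  induction i using Fin.induction with
  | zero => simp [RelSeries.head]
  | succ i ih =>
    have hstep := Order.covBy_iff_add_one_eq.1 (CovBy.grade ℤ (s.step i))
    rw [← hstep, ← ih, Fin.val_succ, Fin.val_castSucc]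
    push_cast
    ring

end GradeOrder

theorem isCatenaryRing_of_gradeOrder_Iic {R : Type u} [CommRing R]
    (H : ∀ q : PrimeSpectrum R, Nonempty (GradeOrder ℤ (Set.Iic q))) : IsCatenaryRing R := by
  intro p q hpq
  obtain ⟨_⟩ := H q
  let p' : Set.Iic q := ⟨p, hpq⟩
  let q' : Set.Iic q := ⟨q, Set.self_mem_Iic⟩
  refine ⟨(grade ℤ q' - grade ℤ p').toNat, fun s hp hq => ?_, fun s hp hq => ?_⟩
  · have hle : ∀ i, s i ≤ q := fun i => hq ▸ s.monotone (Fin.le_last i)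
    let t : LTSeries (Set.Iic q) := ⟨s.length, fun i => ⟨s i, hle i⟩, s.step⟩
    have ht : s.length + grade ℤ t.head ≤ grade ℤ t.last := length_add_grade_head_le_grade_last t
    rw [show t.head = p' from Subtype.ext hp, show t.last = q' from Subtype.ext hq] at ht
    lia
  · have hle : ∀ i, s i ≤ q := by
      intro i
      induction i using Fin.reverseInduction with
      | last => exact hq.le
      | cast i ih => exact (s.step i : s i.castSucc ⋖ s i.succ).le.trans ih
    let t : RelSeries {(a, b) : Set.Iic q × Set.Iic q | a ⋖ b} :=
      ⟨s.length, fun i => ⟨s i, hle i⟩, fun i => .of_image (OrderEmbedding.subtype _) (s.step i)⟩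
    have ht : s.length + grade ℤ t.head = grade ℤ t.last := length_add_grade_head_eq_grade_last t
    rw [show t.head = p' from Subtype.ext hp, show t.last = q' from Subtype.ext hq] at ht
    lia

theorem isCatenaryRing_of_gradeOrder_localization {R : Type u} [CommRing R]
    (H : ∀ (q : Ideal R) [q.IsPrime],
      Nonempty (GradeOrder ℤ (PrimeSpectrum (Localization.AtPrime q)))) :
    IsCatenaryRing R := by
  refine isCatenaryRing_of_gradeOrder_Iic fun q => ?_
  obtain ⟨_⟩ := H q.asIdeal
  let e : Set.Iic q ≃o PrimeSpectrum (Localization.AtPrime q.asIdeal) :=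
    (IsLocalization.AtPrime.primeSpectrumOrderIso _ q.asIdeal).symm
  exact ⟨.liftRight e e.strictMono fun _ _ => (apply_covBy_apply_iff e).2⟩

theorem nonempty_gradeOrder_primeSpectrum_of_isLocalization {R : Type*} [CommRing R]
    [GradeOrder ℤ (PrimeSpectrum R)] (M : Submonoid R) (S : Type*) [CommRing S] [Algebra R S]
    [IsLocalization M S] : Nonempty (GradeOrder ℤ (PrimeSpectrum S)) := by
  let f : PrimeSpectrum S ↪o PrimeSpectrum R :=
    (IsLocalization.primeSpectrumOrderIso M S).toOrderEmbedding.trans (OrderEmbedding.subtype _)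
  have hf : (Set.range f).OrdConnected := by
    have hrange : Set.range f = {p | Disjoint (M : Set R) p.asIdeal} := by
      simp [f, Set.range_comp]
    rw [hrange]
    exact IsLowerSet.ordConnected fun p q hqp hp => hp.mono_right hqp
  exact ⟨.liftRight f f.strictMono fun _ _ => (Set.OrdConnected.apply_covBy_apply_iff f hf).2⟩

end Catenary

section Dimension

theorem ringKrullDim_eq_of_isIntegral (R S : Type*) [CommRing R] [CommRing S] [Algebra R S]
    [FaithfulSMul R S] [Algebra.IsIntegral R S] : ringKrullDim S = ringKrullDim R := by
  apply le_antisymm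
  · exact Order.krullDim_le_of_strictMono (PrimeSpectrum.comap (algebraMap R S))
      fun p q hpq => Ideal.IsIntegral.comap_lt_comap hpq
  · refine iSup_le fun l => ?_
    obtain ⟨⟨P, _, _⟩⟩ := Ideal.nonempty_primesOver (S := S) l.head.asIdeal
    obtain ⟨L, hL, -⟩ := Ideal.exists_ltSeries_of_hasGoingUp l P
    exact hL ▸ Order.LTSeries.length_le_krullDim L

theorem height_eq_natCard_of_isMaximal {K ι : Type*} [Field K] [Finite ι]
    (m : Ideal (MvPolynomial ι K)) [m.IsMaximal] : m.height = Nat.card ι := by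
  induction ι using Finite.induction_empty_option with
  | of_equiv e ih =>
    let e' := (MvPolynomial.renameEquiv K e).symm.toRingEquiv
    have : (m.map e').IsMaximal := Ideal.map_isMaximal_of_equiv e'
    rw [← RingEquiv.height_map e' m, ih, Nat.card_congr e]
  | h_empty =>
    have h := Ideal.height_le_ringKrullDim_of_isPrime (I := m)
    rw [MvPolynomial.ringKrullDim_of_isNoetherianRing, ringKrullDim_eq_zero_of_field] at h
    simpa using h
  | @h_option κ _ ih =>
    let e := (MvPolynomial.optionEquivLeft K κ).toRingEquiv
    have : (m.map e).IsMaximal := Ideal.map_isMaximal_of_equiv e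
    let m₀ : Ideal (MvPolynomial κ K) := (m.map e).under (MvPolynomial κ K)
    have : m₀.IsMaximal := Polynomial.isMaximal_comap_C_of_isJacobsonRing _
    have : (m.map e).LiesOver m₀ := ⟨rfl⟩
    rw [← RingEquiv.height_map e m, Polynomial.height_eq_height_add_one m₀, ih]
    simp

theorem ringKrullDim_mvPolynomial_le_quotient_span_singleton_add_one {K ι : Type*} [Field K]
    [Finite ι] {f : MvPolynomial ι K} (hf : ¬ IsUnit f) :
    ringKrullDim (MvPolynomial ι K) ≤ ringKrullDim (MvPolynomial ι K ⧸ Ideal.span {f}) + 1 := by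
  obtain ⟨m, _, hfm⟩ := exists_max_ideal_of_mem_nonunits hf
  simpa [height_eq_natCard_of_isMaximal] using Ideal.height_le_ringKrullDim_quotient_add_one hfm

theorem exists_prime_under_eq_span_singleton_of_bot_covBy {A R : Type*} [CommRing A] [IsDomain A]
    [UniqueFactorizationMonoid A] [CommRing R] [IsDomain R] [Algebra A R] [FaithfulSMul A R]
    [Algebra.IsIntegral A R] [Algebra.HasGoingDown A R] {q : PrimeSpectrum R} (hq : ⊥ ⋖ q) :
    ∃ f : A, Prime f ∧ q.asIdeal.under A = Ideal.span {f} := by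
  have hq0 : q.asIdeal ≠ ⊥ := fun h => hq.ne' (PrimeSpectrum.ext h)
  obtain ⟨f, hfq, hf⟩ := Ideal.IsPrime.exists_mem_prime_of_ne_bot
    (I := q.asIdeal.under A) inferInstance (Ideal.IsIntegral.comap_ne_bot _ hq0)
  have : (Ideal.span {f}).IsPrime := (Ideal.span_singleton_prime hf.ne_zero).2 hf
  obtain ⟨P, hPq, hP, hPf⟩ := Ideal.exists_ideal_le_liesOver_of_le (p := Ideal.span {f})
    (q := q.asIdeal.under A) q.asIdeal ((Ideal.span_singleton_le_iff_mem _).2 hfq)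
  refine ⟨f, hf, ?_⟩
  obtain hPbot | hPq : (⟨P, hP⟩ : PrimeSpectrum R) = ⊥ ∨ ⟨P, hP⟩ = q := hq.eq_or_eq bot_le hPq
  · have hfP : f ∈ P.under A := hPf.over ▸ Ideal.mem_span_singleton_self f
    obtain rfl : P = ⊥ := congrArg PrimeSpectrum.asIdeal hPbot
    exact absurd ((FaithfulSMul.algebraMap_eq_zero_iff A R).1 hfP) hf.ne_zero
  · rw [← hPq, hPf.over]

theorem ringKrullDim_quotient_add_one_le_of_lt {R : Type*} [CommRing R] {p q : PrimeSpectrum R}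
    (hpq : p < q) : ringKrullDim (R ⧸ q.asIdeal) + 1 ≤ ringKrullDim (R ⧸ p.asIdeal) := by
  obtain ⟨x, hxq, hxp⟩ := SetLike.exists_of_lt (show p.asIdeal < q.asIdeal from hpq)
  refine ringKrullDim_succ_le_of_surjective (Ideal.Quotient.factor hpq.le)
    (Ideal.Quotient.factor_surjective hpq.le) (r := Ideal.Quotient.mk _ x) ?_ ?_
  · exact mem_nonZeroDivisors_of_ne_zero (mt Ideal.Quotient.eq_zero_iff_mem.1 hxp)
  · exact Ideal.Quotient.eq_zero_iff_mem.2 hxq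

section FiniteType

variable (K : Type*) [Field K]

theorem exists_ringKrullDim_eq_natCast_of_finiteType (R : Type*) [CommRing R] [Nontrivial R]
    [Algebra K R] [Algebra.FiniteType K R] : ∃ n : ℕ, ringKrullDim R = n := by
  obtain ⟨n, g, hg, _⟩ := exists_integral_inj_algHom_of_fg K R
  algebraize [g.toRingHom]
  have : FaithfulSMul (MvPolynomial (Fin n) K) R := (faithfulSMul_iff_algebraMap_injective _ _).2 hg
  refine ⟨n, ?_⟩
  rw [ringKrullDim_eq_of_isIntegral (MvPolynomial (Fin n) K),
    MvPolynomial.ringKrullDim_of_isNoetherianRing, ringKrullDim_eq_zero_of_field]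
  simp

theorem ringKrullDim_le_quotient_add_one_of_bot_covBy {R : Type*} [CommRing R] [IsDomain R]
    [Algebra K R] [Algebra.FiniteType K R] {q : PrimeSpectrum R} (hq : ⊥ ⋖ q) :
    ringKrullDim R ≤ ringKrullDim (R ⧸ q.asIdeal) + 1 := by
  obtain ⟨n, g, hg, _⟩ := exists_integral_inj_algHom_of_fg K R
  algebraize [g.toRingHom]
  have : FaithfulSMul (MvPolynomial (Fin n) K) R := (faithfulSMul_iff_algebraMap_injective _ _).2 hg
  obtain ⟨f, hf, hqf⟩ := exists_prime_under_eq_span_singleton_of_bot_covBy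
    (A := MvPolynomial (Fin n) K) hq
  rw [ringKrullDim_eq_of_isIntegral (MvPolynomial (Fin n) K) R, ringKrullDim_eq_of_isIntegral
    (MvPolynomial (Fin n) K ⧸ q.asIdeal.under (MvPolynomial (Fin n) K)) (R ⧸ q.asIdeal), hqf]
  exact ringKrullDim_mvPolynomial_le_quotient_span_singleton_add_one hf.not_isUnit

theorem ringKrullDim_quotient_le_add_one_of_covBy {R : Type*} [CommRing R] [Algebra K R]
    [Algebra.FiniteType K R] {p q : PrimeSpectrum R} (hpq : p ⋖ q) :
    ringKrullDim (R ⧸ p.asIdeal) ≤ ringKrullDim (R ⧸ q.asIdeal) + 1 := by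
  let e := Ideal.primeSpectrumQuotientOrderIsoZeroLocus p.asIdeal
  have hbot : (e ⊥ : PrimeSpectrum R) = p := PrimeSpectrum.ext (Ideal.mk_ker (I := p.asIdeal))
  obtain ⟨q', hq'⟩ : ∃ q', e q' = ⟨q, hpq.le⟩ := e.surjective _
  have hcov : ⊥ ⋖ q' := by
    refine (apply_covBy_apply_iff e).1 (.of_image (OrderEmbedding.subtype _) ?_)
    simpa [hbot, hq'] using hpq
  have hmap : q'.asIdeal = q.asIdeal.map (Ideal.Quotient.mk p.asIdeal) := by
    rw [← e.symm_apply_apply q', hq']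
    rfl
  rw [← ringKrullDim_eq_of_ringEquiv (DoubleQuot.quotQuotEquivQuotOfLE hpq.le), ← hmap]
  exact ringKrullDim_le_quotient_add_one_of_bot_covBy K hcov

theorem nonempty_gradeOrder_primeSpectrum_of_finiteType (R : Type*) [CommRing R] [Algebra K R]
    [Algebra.FiniteType K R] : Nonempty (GradeOrder ℤ (PrimeSpectrum R)) := by
  choose d hd using fun p : PrimeSpectrum R =>
    exists_ringKrullDim_eq_natCast_of_finiteType K (R ⧸ p.asIdeal)
  have hlt : ∀ p q : PrimeSpectrum R, p < q → d q + 1 ≤ d p := fun p q hpq => by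
    have := ringKrullDim_quotient_add_one_le_of_lt hpq
    rw [hd, hd] at this
    exact_mod_cast this
  have hcov : ∀ p q : PrimeSpectrum R, p ⋖ q → d p ≤ d q + 1 := fun p q hpq => by
    have := ringKrullDim_quotient_le_add_one_of_covBy K hpq
    rw [hd, hd] at this
    exact_mod_cast this
  refine ⟨⟨fun p => -(d p : ℤ), fun p q hpq => ?_, fun p q hpq => ?_⟩⟩
  · have := hlt p q hpq
    lia
  · have := hlt p q hpq.lt
    have := hcov p q hpq
    exact Order.covBy_iff_add_one_eq.2 (by lia)

theorem nonempty_gradeOrder_primeSpectrum_of_essFiniteType (R : Type*) [CommRing R] [Algebra K R]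
    [Algebra.EssFiniteType K R] : Nonempty (GradeOrder ℤ (PrimeSpectrum R)) := by
  obtain ⟨_⟩ := nonempty_gradeOrder_primeSpectrum_of_finiteType K
    (Algebra.EssFiniteType.subalgebra K R)
  exact nonempty_gradeOrder_primeSpectrum_of_isLocalization (Algebra.EssFiniteType.submonoid K R) R

end FiniteType

end Dimension

section Criteria

theorem isUniversallyCatenaryRing_of_essFiniteType_localization {B : Type u} [CommRing B]
    [IsNoetherianRing B] (H : ∀ (P : Ideal B) [P.IsPrime],
      ∃ (K : Type*) (_ : Field K) (f : K →+* Localization.AtPrime P), f.EssFiniteType) :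
    IsUniversallyCatenaryRing B where
  isNoetherianRing := inferInstance
  isCatenaryRing C _ _ _ := by
    refine isCatenaryRing_of_gradeOrder_localization fun q _ => ?_
    obtain ⟨K, _, f, hf⟩ := H (q.under B)
    let g := Localization.localRingHom (q.under B) q (algebraMap B C) rfl
    have hg : g.EssFiniteType := by
      refine .of_comp (algebraMap B (Localization.AtPrime (q.under B))) ?_
      rw [show g.comp (algebraMap B _) = algebraMap B (Localization.AtPrime q) from
        RingHom.ext fun b => Localization.localRingHom_to_map _ _ _ rfl b]
      exact RingHom.essFiniteType_algebraMap.2 inferInstance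
    let := (g.comp f).toAlgebra
    have : Algebra.EssFiniteType K (Localization.AtPrime q) := hf.comp hg
    exact nonempty_gradeOrder_primeSpectrum_of_essFiniteType K _

theorem exists_fg_le_forall_exists_mul_mem {R : Type*} [CommRing R] (I M : Ideal R) [M.IsPrime]
    [IsNoetherianRing (Localization.AtPrime M)] :
    ∃ J : Ideal R, J.FG ∧ J ≤ I ∧ ∀ x ∈ I, ∃ s ∉ M, s * x ∈ J := by
  classical
  have hfg : (I.map (algebraMap R (Localization.AtPrime M))).FG := IsNoetherian.noetherian _
  obtain ⟨T, hT, hspan⟩ := (Submodule.fg_span_iff_fg_span_finset_subset _).1 hfg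
  obtain ⟨U, hUI, rfl⟩ := Finset.subset_set_image_iff.1 hT
  refine ⟨Ideal.span U, ⟨U, rfl⟩, Ideal.span_le.2 hUI, fun x hx => ?_⟩
  refine (IsLocalization.algebraMap_mem_map_algebraMap_iff M.primeCompl
    (Localization.AtPrime M) _ _).1 ?_
  rw [Ideal.map_span, ← Finset.coe_image, Ideal.span, ← hspan]
  exact Ideal.mem_map_of_mem _ hx

theorem isNoetherianRing_of_finite_setOf_isMaximal_of_localization {R : Type*} [CommRing R]
    (hfin : ∀ f : R, f ≠ 0 → {M : Ideal R | M.IsMaximal ∧ f ∈ M}.Finite)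
    (hloc : ∀ (M : Ideal R) [M.IsMaximal], IsNoetherianRing (Localization.AtPrime M)) :
    IsNoetherianRing R := by
  rw [isNoetherianRing_iff_ideal_fg]
  intro I
  by_cases hI : I = ⊥
  · exact hI ▸ Submodule.fg_bot
  obtain ⟨f, hf, hf0⟩ := Submodule.exists_mem_ne_zero_of_ne_bot hI
  have := (hfin f hf0).to_subtype
  have hJ : ∀ M : {M : Ideal R | M.IsMaximal ∧ f ∈ M}, ∃ J : Ideal R, J.FG ∧ J ≤ I ∧
      ∀ x ∈ I, ∃ s ∉ M.1, s * x ∈ J := by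
    rintro ⟨M, _, -⟩
    have := hloc M
    exact exists_fg_le_forall_exists_mul_mem I M
  choose J hJfg hJI hJ using hJ
  -- `f` takes care of the maximal ideals that do not contain it.
  let J₀ : Ideal R := Ideal.span {f} ⊔ ⨆ M, J M
  have hJ₀fg : J₀.FG := (Submodule.fg_span_singleton f).sup (Submodule.fg_iSup _ hJfg)
  suffices I = J₀ from this ▸ hJ₀fg
  refine le_antisymm (fun x hx => ?_)
    (sup_le ((Ideal.span_singleton_le_iff_mem _).2 hf) (iSup_le hJI))
  suffices hcolon : J₀.colon {x} = ⊤ by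
    simpa [Submodule.mem_colon_singleton] using (Ideal.eq_top_iff_one _).1 hcolon
  by_contra hne
  obtain ⟨M, hM, hle⟩ := Ideal.exists_le_maximal _ hne
  by_cases hfM : f ∈ M
  · obtain ⟨s, hs, hsx⟩ := hJ ⟨M, hM, hfM⟩ x hx
    have hsJ₀ : s * x ∈ J₀ := (le_iSup J ⟨M, hM, hfM⟩).trans le_sup_right hsx
    exact hs (hle (Submodule.mem_colon_singleton.2 hsJ₀))
  · have hfJ₀ : f * x ∈ J₀ :=
      Ideal.mul_mem_right _ _ (le_sup_left (α := Ideal R) (Ideal.mem_span_singleton_self f))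
    exact hfM (hle (Submodule.mem_colon_singleton.2 hfJ₀))

end Criteria

section VariableIdeals

open MvPolynomial

variable {σ R : Type*} [CommRing R]

theorem ker_killCompl {τ : Type*} {f : τ → σ} (hf : f.Injective) :
    RingHom.ker (killCompl (R := R) hf) = Ideal.span (X '' (Set.range f)ᶜ) := by
  ext p
  have hrange (m : σ →₀ ℕ) :
      m ∉ Set.range (Finsupp.mapDomain f) ↔ ∃ i ∈ (Set.range f)ᶜ, m i ≠ 0 := by
    rw [Finsupp.mem_range_mapDomain_iff _ hf]
    push Not
    rfl
  simp only [RingHom.mem_ker, ← support_eq_empty, support_killCompl, mem_ideal_span_X_image,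
    ← hrange, Finset.eq_empty_iff_forall_notMem, Finset.mem_preimage, Set.mem_range, not_exists]
  exact ⟨fun h m hm e he => h e (he ▸ hm), fun h e he => h _ he e rfl⟩

theorem span_X_image_eq_ker_killCompl (t : Set σ) : Ideal.span (X '' t) =
    RingHom.ker (killCompl (R := R) (f := ((↑) : ↥tᶜ → σ)) Subtype.val_injective) := by
  rw [ker_killCompl, Subtype.range_coe, compl_compl]

theorem isPrime_span_X_image [IsDomain R] (t : Set σ) :
    (Ideal.span (X '' t) : Ideal (MvPolynomial σ R)).IsPrime :=
  span_X_image_eq_ker_killCompl (R := R) t ▸ RingHom.ker_isPrime _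

theorem comap_rename_span_X_image (t : Set σ) :
    (Ideal.span (X '' t)).comap (rename (R := R) ((↑) : ↥tᶜ → σ)) = ⊥ := by
  ext r
  rw [span_X_image_eq_ker_killCompl, Ideal.mem_comap, RingHom.mem_ker, killCompl_rename_app,
    Ideal.mem_bot]

theorem mem_span_X_image_of_add_mem {t : Set σ} {f g : MvPolynomial σ R}
    (hfg : Disjoint f.support g.support) (h : f + g ∈ Ideal.span (X '' t)) :
    f ∈ Ideal.span (X '' t) := by
  refine mem_ideal_span_X_image.2 fun m hm => mem_ideal_span_X_image.1 h m ?_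
  rw [mem_support_iff, coeff_add, notMem_support_iff.1 (Finset.disjoint_left.1 hfg hm), add_zero]
  exact mem_support_iff.1 hm

variable {ν : Type*} {s : ν → Set σ}

theorem finite_setOf_mem_span_X_image (hpt : ∀ i, {n | i ∈ s n}.Finite) {f : MvPolynomial σ R}
    (hf : f ≠ 0) : {n | f ∈ Ideal.span (X '' s n)}.Finite := by
  obtain ⟨m, hm⟩ := support_nonempty.2 hf
  refine (m.support.finite_toSet.biUnion fun i _ => hpt i).subset fun n hn => ?_
  obtain ⟨i, his, hi⟩ := mem_ideal_span_X_image.1 hn m hm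
  exact Set.mem_biUnion (Finsupp.mem_support_iff.2 hi) his

theorem exists_le_span_X_image_of_forall_exists_mem [IsDomain R]
    (hpt : ∀ i, {n | i ∈ s n}.Finite) {I : Ideal (MvPolynomial σ R)}
    (hI : ∀ f ∈ I, ∃ n, f ∈ Ideal.span (X '' s n)) :
    ∃ n, I ≤ Ideal.span (X '' s n) := by
  by_contra! hne
  obtain ⟨n₀, -⟩ := hI 0 I.zero_mem
  have hI0 : I ≠ ⊥ := fun h => hne n₀ (h ▸ bot_le)
  obtain ⟨f, hf, hf0⟩ := Submodule.exists_mem_ne_zero_of_ne_bot hI0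
  obtain ⟨g, hg, hgn⟩ : ∃ g ∈ I, ∀ n, f ∈ Ideal.span (X '' s n) → g ∉ Ideal.span (X '' s n) := by
    by_contra! h
    obtain ⟨n, -, hn⟩ := (Ideal.subset_union_prime_finite (finite_setOf_mem_span_X_image hpt hf0)
      n₀ n₀ fun n _ _ _ => isPrime_span_X_image (s n)).1 fun g hg => by
        simpa using h g hg
    exact hne n hn
  -- `g` has no constant term, so its high powers have no monomial in common with `f`.
  let h := g ^ (f.totalDegree + 1)
  have hdisj : Disjoint f.support h.support := by
    obtain ⟨n, hn⟩ := hI g hg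
    have hgX : h ∈ idealOfVars σ R ^ (f.totalDegree + 1) :=
      Ideal.pow_mem_pow (Ideal.span_mono (Set.image_subset_range X (s n)) hn) _
    exact Finset.disjoint_left.2 fun m hmf hmh =>
      ((mem_pow_idealOfVars_iff _ _).1 hgX m hmh).not_gt (Nat.lt_succ_of_le (le_totalDegree hmf))
  obtain ⟨n, hn⟩ := hI (f + h) (I.add_mem hf (I.pow_mem_of_mem hg _ (Nat.succ_pos _)))
  have hfn := mem_span_X_image_of_add_mem hdisj hn
  have hhn := (Ideal.add_mem_iff_right _ hfn).1 hn
  exact hgn n hfn ((isPrime_span_X_image (s n)).mem_of_pow_mem _ hhn)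

end VariableIdeals

section LocalRings

open MvPolynomial

theorem exists_algEquiv_mvPolynomial_compl {σ : Type*} (R : Type*) [CommRing R] (t : Set σ) :
    ∃ e : MvPolynomial t (MvPolynomial ↥tᶜ R) ≃ₐ[R] MvPolynomial σ R,
      ∀ r, e (C r) = rename (↑) r := by
  classical
  refine ⟨(sumAlgEquiv R t ↥tᶜ).symm.trans (renameEquiv R (Equiv.Set.sumCompl t)), fun r => ?_⟩
  have h : sumAlgEquiv R t ↥tᶜ (rename Sum.inr r) = C r :=
    DFunLike.congr_fun (sumAlgEquiv_comp_rename_inr R t ↥tᶜ) r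
  rw [AlgEquiv.trans_apply, ← h, AlgEquiv.symm_apply_apply, renameEquiv_apply, rename_rename]
  rfl

attribute [local instance] MvPolynomial.algebraMvPolynomial in
theorem exists_ringEquiv_localization_fractionRing {R ι : Type*} [CommRing R] [IsDomain R]
    (P : Ideal (MvPolynomial ι R)) [P.IsPrime] (hP : P.comap C = ⊥) :
    ∃ (Q : Ideal (MvPolynomial ι (FractionRing R))) (_ : Q.IsPrime),
      Nonempty (Localization.AtPrime P ≃+* Localization.AtPrime Q) := by
  let M := (nonZeroDivisors R).map (C (σ := ι))
  have : IsLocalization M (MvPolynomial ι (FractionRing R)) := MvPolynomial.isLocalization _ _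
  have hdisj : Disjoint (M : Set (MvPolynomial ι R)) P := by
    rw [Set.disjoint_left]
    rintro _ ⟨r, hr, rfl⟩ hrP
    have : r ∈ P.comap C := hrP
    exact nonZeroDivisors.ne_zero hr (by rwa [hP] at this)
  let Q := P.map (algebraMap (MvPolynomial ι R) (MvPolynomial ι (FractionRing R)))
  have hQ : Q.IsPrime := IsLocalization.isPrime_of_isPrime_disjoint M _ _ ‹_› hdisj
  have : IsLocalization.AtPrime (Localization.AtPrime Q) P := by
    convert IsLocalization.isLocalization_isLocalization_atPrime_isLocalization M
      (Localization.AtPrime Q) Q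
    exact (IsLocalization.under_map_of_isPrime_disjoint M _ ‹_› hdisj).symm
  exact ⟨Q, hQ, ⟨(IsLocalization.algEquiv P.primeCompl _ _).toRingEquiv⟩⟩

theorem exists_ringEquiv_localization_of_le_span_X_image {σ R : Type*} [CommRing R] [IsDomain R]
    {t : Set σ} (p : Ideal (MvPolynomial σ R)) [p.IsPrime] (hp : p ≤ Ideal.span (X '' t)) :
    ∃ (Q : Ideal (MvPolynomial t (FractionRing (MvPolynomial ↥tᶜ R)))) (_ : Q.IsPrime),
      Nonempty (Localization.AtPrime p ≃+* Localization.AtPrime Q) := by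
  obtain ⟨e, he⟩ := exists_algEquiv_mvPolynomial_compl R t
  let P := p.comap e.toRingEquiv
  have hP : P.comap C = ⊥ := by
    rw [eq_bot_iff, ← comap_rename_span_X_image t]
    intro r hr
    exact hp (he r ▸ hr)
  obtain ⟨Q, hQ, ⟨e'⟩⟩ := exists_ringEquiv_localization_fractionRing P hP
  let eP : Localization.AtPrime P ≃+* Localization.AtPrime p :=
    IsLocalization.ringEquivOfRingEquiv _ _ e.toRingEquiv (e.toRingEquiv.map_primeCompl_comap_eq p)
  exact ⟨Q, hQ, ⟨eP.symm.trans e'⟩⟩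

theorem essFiniteType_comp_algebraMap_localization {K ι S : Type*} [CommRing K] [Finite ι]
    [CommRing S] (Q : Ideal (MvPolynomial ι K)) [Q.IsPrime] (e : Localization.AtPrime Q ≃+* S) :
    (e.toRingHom.comp (algebraMap K (Localization.AtPrime Q))).EssFiniteType :=
  have hQ : Algebra.EssFiniteType K (Localization.AtPrime Q) := .comp K (MvPolynomial ι K) _
  (RingHom.essFiniteType_algebraMap.2 hQ).comp
    (RingHom.FiniteType.of_surjective _ e.surjective).essFiniteType

end LocalRings

section LocalizationAwayFromPrimes

variable {A ν : Type*} [CommRing A] {𝔭 : ν → Ideal A} {M : Submonoid A}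
  (hM : ∀ f, f ∈ M ↔ ∀ n, f ∉ 𝔭 n)
  (havoid : ∀ I : Ideal A, (∀ f ∈ I, ∃ n, f ∈ 𝔭 n) → ∃ n, I ≤ 𝔭 n)
  {B : Type*} [CommRing B] [Algebra A B] [IsLocalization M B]

include hM havoid

theorem exists_under_le_of_isPrime (P : Ideal B) [P.IsPrime] : ∃ n, P.under A ≤ 𝔭 n := by
  refine havoid _ fun f hf => ?_
  by_contra! h
  have hdisj := ((IsLocalization.isPrime_iff_isPrime_disjoint M B P).1 ‹_›).2
  exact Set.disjoint_left.1 hdisj ((hM f).2 h) hf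

theorem finite_setOf_isMaximal_mem [∀ n, (𝔭 n).IsPrime]
    (hfin : ∀ f : A, f ≠ 0 → {n | f ∈ 𝔭 n}.Finite) {b : B} (hb : b ≠ 0) :
    {N : Ideal B | N.IsMaximal ∧ b ∈ N}.Finite := by
  obtain ⟨f, m, rfl⟩ := IsLocalization.exists_mk'_eq M b
  have hf : f ≠ 0 := by
    rintro rfl
    exact hb (IsLocalization.mk'_zero m)
  refine ((hfin f hf).image fun n => (𝔭 n).map (algebraMap A B)).subset ?_
  rintro N ⟨hN, hfN⟩
  obtain ⟨n, hn⟩ := exists_under_le_of_isPrime hM havoid N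
  have hfN' : f ∈ N.under A := (IsLocalization.mk'_mem_iff).1 hfN
  have : ((𝔭 n).map (algebraMap A B)).IsPrime :=
    IsLocalization.isPrime_of_isPrime_disjoint M _ _ inferInstance
      (Set.disjoint_left.2 fun x hx => (hM x).1 hx n)
  refine ⟨n, hn hfN', (hN.eq_of_le this.ne_top ?_).symm⟩
  rw [← IsLocalization.map_under M B N]
  exact Ideal.map_mono hn

end LocalizationAwayFromPrimes

section PointFinite

open MvPolynomial

variable {R σ ν : Type*} [CommRing R] [IsDomain R] {s : ν → Set σ}
  (hs : ∀ n, (s n).Finite) (hpt : ∀ i, {n | i ∈ s n}.Finite)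
  {M : Submonoid (MvPolynomial σ R)} (hM : ∀ f, f ∈ M ↔ ∀ n, f ∉ Ideal.span (X '' s n))
  {B : Type*} [CommRing B] [Algebra (MvPolynomial σ R) B] [IsLocalization M B]

include hpt hM

theorem exists_ringEquiv_localization_of_pointFinite (P : Ideal B) [P.IsPrime] :
    ∃ (n : ν) (Q : Ideal (MvPolynomial (s n) (FractionRing (MvPolynomial ↥(s n)ᶜ R))))
      (_ : Q.IsPrime), Nonempty (Localization.AtPrime P ≃+* Localization.AtPrime Q) := by
  obtain ⟨n, hn⟩ := exists_under_le_of_isPrime hM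
    (fun _ => exists_le_span_X_image_of_forall_exists_mem hpt) P
  obtain ⟨Q, hQ, ⟨e⟩⟩ := exists_ringEquiv_localization_of_le_span_X_image _ hn
  have : IsLocalization.AtPrime (Localization.AtPrime P) (P.under (MvPolynomial σ R)) :=
    IsLocalization.isLocalization_isLocalization_atPrime_isLocalization M _ P
  let eP := IsLocalization.algEquiv (P.under (MvPolynomial σ R)).primeCompl
    (Localization.AtPrime P) (Localization.AtPrime (P.under (MvPolynomial σ R)))
  exact ⟨n, Q, hQ, ⟨eP.toRingEquiv.trans e⟩⟩

include hs

theorem isNoetherianRing_of_pointFinite : IsNoetherianRing B := by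
  have (n : ν) := isPrime_span_X_image (R := R) (s n)
  refine isNoetherianRing_of_finite_setOf_isMaximal_of_localization (fun b hb => ?_) fun N _ => ?_
  · exact finite_setOf_isMaximal_mem hM
      (fun _ => exists_le_span_X_image_of_forall_exists_mem hpt)
      (fun f hf => finite_setOf_mem_span_X_image hpt hf) hb
  · obtain ⟨n, Q, _, ⟨e⟩⟩ := exists_ringEquiv_localization_of_pointFinite hpt hM N
    have := (hs n).to_subtype
    exact isNoetherianRing_of_ringEquiv _ e.symm

end PointFinite

open MvPolynomial in
theorem proposition3p8_general {R σ ν : Type*} {B : Type u} [CommRing R] [IsDomain R]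
    {s : ν → Set σ} (hs : ∀ n, (s n).Finite) (hpt : ∀ i, {n | i ∈ s n}.Finite)
    {M : Submonoid (MvPolynomial σ R)} (hM : ∀ f, f ∈ M ↔ ∀ n, f ∉ Ideal.span (X '' s n))
    [CommRing B] [Algebra (MvPolynomial σ R) B] [IsLocalization M B] :
    IsRegularRing B ∧ IsUniversallyCatenaryRing B := by
  have := isNoetherianRing_of_pointFinite hs hpt hM (B := B)
  refine ⟨isRegularRing_iff.2 fun P _ => ?_,
    isUniversallyCatenaryRing_of_essFiniteType_localization fun P _ => ?_⟩
  all_goals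
    obtain ⟨n, Q, _, ⟨e⟩⟩ := exists_ringEquiv_localization_of_pointFinite hpt hM P
    have := (hs n).to_subtype
  · exact IsRegularLocalRing.of_ringEquiv (R := Localization.AtPrime Q) e.symm
  · exact ⟨_, inferInstance, _, essFiniteType_comp_algebraMap_localization Q e.symm⟩

theorem proposition3p8 (k : Type u) [Field k] :
    IsRegularRing (NagataExample.B k) ∧ IsUniversallyCatenaryRing (NagataExample.B k) :=
  proposition3p8_general (M := NagataExample.S k) (fun n => Set.finite_range (Sigma.mk n))
    (fun i => by simp [Set.range_sigmaMk]) fun f => by simp only [← Set.range_comp]; rfl
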